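/- Let $Z_1,\dots,Z_m$ be $n\times n$ complex positive semidefinite matrices, and suppose that the eigenvalues $r_{i1},\dots,r_{in}$ of $Z_i$ (listed with multiplicity, in any order) satisfy $0\le r_{ik}<1$ for all $i,k$. Let $w_1,\dots,w_m>0$ with $\sum_{i=1}^m w_i=1$, put $W=\sum_{i=1}^m w_iZ_i$, and let $U$ be an $n\times n$ unitary matrix. For a square complex matrix $X$ let $\mathrm{Spec}(X)$ denote the multiset of its eigenvalues, counted with algebraic multiplicity. Then $\det(I-UW)\ne0$, the number $\det(I-W^2)$ is real, and $$\prod_{k=1}^n\prod_{i=1}^m\left(\frac{1-r_{ik}}{1+r_{ik}}\right)^{w_i}\le\frac{\det(I-W^2)}{|\det(I-UW)|^2}\le\prod_{k=1}^n\prod_{i=1}^m\left(\frac{1+r_{ik}}{1-r_{ik}}\right)^{w_i}.$$ Equality on the left-hand side holds if and only if all $Z_i$ are equal to one matrix $Z$ such that $1\in\mathrm{Spec}(Z)$ or $\mathrm{Spec}(UZ)=\mathrm{Spec}(-Z)$; in this case, if $Z$ is nonsingular, then $U=-I$. Equality on the right-hand side holds if and only if all $Z_i$ are equal to one matrix $Z$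 such that $\mathrm{Spec}(UZ)=\mathrm{Spec}(Z)$; in this case, if $Z$ is nonsingular, then $U=I$. -/

import Mathlib

open scoped ComplexOrder

/-- The spectrum of a complex square matrix: its eigenvalues, as a multiset, each repeated
according to its algebraic multiplicity. -/
noncomputable def Spec {n : ℕ} (A : Matrix (Fin n) (Fin n) ℂ) : Multiset ℂ :=
  A.charpoly.roots

namespace Matrix

variable {ι : Type*} [Fintype ι] [DecidableEq ι]

/-! Put `a = det (1 - W)`, `b = det (1 + W)` and `d = |det (1 - U W)|`. Then `det (1 - W²) = a b`,
and `a ≤ d ≤ b` places the quotient `a b / d²` between `a / b` and `b / a`. Moreover `log (b / a)`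
is the sum of `g x = log ((1 + x) / (1 - x))` over the eigenvalues of `W`. Since `g` is strictly
convex on `[0, 1)`, Jensen's inequality for traces bounds it by the weighted sums over the
eigenvalues of the `Z i`.

The bounds on `d` are variational (`norm_det_one_sub_le`, `norm_det_one_sub_le_one_add`). By
compactness `|det (1 - V W)|` attains its extrema over unitary `V`. Rotating single lines shows that
`V W` is Hermitian there, and its square is `W²`, so it is diagonal in an eigenbasis of `W` with
eigenvalues changed only in sign; the factors are then compared one by one.

Equality forces `U W = ∓W` together with equality in Jensen, that is, all `Z i = W`. Invertibility
then cancels `W`. The alternative `1 ∈ Spec Z` never occurs, as all `r i k < 1`. -/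

lemma _root_.Complex.im_eq_zero_of_forall_re_mul_le {c : ℂ}
    (h : ∀ z : ℂ, ‖z‖ = 1 → (c * z).re ≤ c.re) : c.im = 0 := by
  by_cases hc : c = 0
  · simp [hc]
  have hn : ‖c‖ ≠ 0 := by simpa using hc
  -- This `z` turns `c` onto the positive real axis, giving `‖c‖ ≤ c.re`.
  have h1 := h (star c / ‖c‖) (by simp [hn])
  have h2 : c * (star c / ‖c‖) = (‖c‖ : ℂ) := by
    have : c * star c = (‖c‖ : ℂ) ^ 2 := by simpa using Complex.mul_conj' c
    rw [mul_div_assoc', this]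
    field_simp
  rw [h2, Complex.ofReal_re] at h1
  have h3 := Complex.sq_norm c
  rw [Complex.normSq_apply] at h3
  nlinarith [Complex.re_le_norm c, norm_nonneg c, sq_nonneg c.im]

/-! ### Extremality under rotations of a line -/

/-- Multiplying by `z` on the line spanned by the unit vector `v`, and by `1` on its complement. -/
def lineRotation (v : ι → ℂ) (z : ℂ) : Matrix ι ι ℂ := 1 + (z - 1) • vecMulVec v (star v)

lemma lineRotation_mem_unitaryGroup {v : ι → ℂ} (hv : star v ⬝ᵥ v = 1) {z : ℂ} (hz : ‖z‖ = 1) :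
    lineRotation v z ∈ unitaryGroup ι ℂ := by
  have hP : vecMulVec v (star v) * vecMulVec v (star v) = vecMulVec v (star v) := by
    rw [vecMulVec_mul_vecMulVec, hv, one_smul]
  have hPs : star (vecMulVec v (star v)) = vecMulVec v (star v) := by
    simp [star_eq_conjTranspose, conjTranspose_vecMulVec]
  have hzz : z * star z = 1 := by
    have := Complex.mul_conj' z
    simpa [hz] using this
  rw [mem_unitaryGroup_iff, lineRotation, star_add, star_smul, hPs, star_one]
  simp only [add_mul, mul_add, one_mul, mul_one, smul_mul_assoc, mul_smul_comm, hP, smul_add,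
    smul_smul]
  have : star (z - 1) + (z - 1) + (z - 1) * star (z - 1) = 0 := by
    rw [star_sub, star_one]; linear_combination hzz
  rw [add_assoc, ← add_smul, ← add_smul]
  rw [show z - 1 + ((star (z - 1)) + star (z-1) * (z - 1)) = 0 by linear_combination this]
  simp

/-- A line rotation changes `1 - X` by a rank-one matrix, so the matrix determinant lemma applies.
-/
lemma det_one_sub_lineRotation_mul {X : Matrix ι ι ℂ} (hX : (1 - X).det ≠ 0) (v : ι → ℂ) (z : ℂ) :
    (1 - lineRotation v z * X).det =
      (1 - X).det * (1 - (z - 1) * (star v ⬝ᵥ (X * (1 - X)⁻¹) *ᵥ v)) := by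
  have hu : IsUnit (1 - X).det := hX.isUnit
  have h : 1 - lineRotation v z * X =
      (1 - X) + replicateCol Unit (-(z - 1) • v) * replicateRow Unit (star v ᵥ* X) := by
    rw [← vecMulVec_eq, lineRotation, add_mul, one_mul, smul_mul_assoc, vecMulVec_mul,
      smul_vecMulVec]
    module
  rw [h, det_add_mul _ _ hu]
  congr 1
  rw [det_unique, add_apply, one_apply_eq, ← replicateRow_vecMul, vecMul_vecMul,
    replicateRow_mul_replicateCol_apply, dotProduct_smul, dotProduct_mulVec]
  simp only [smul_eq_mul]
  ring

/-- On the unit circle `‖1 - (z - 1) μ‖²` is a constant minus twice the real part of `conj (1 + μ) μ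
z`. An extremum at `z = 1` makes `conj (1 + μ) μ = μ + |μ|²` real, hence `μ` real. -/
lemma im_dotProduct_eq_zero_of_extremal {X : Matrix ι ι ℂ} (hX : (1 - X).det ≠ 0)
    (h : (∀ V ∈ unitaryGroup ι ℂ, ‖(1 - X).det‖ ≤ ‖(1 - V * X).det‖) ∨
      (∀ V ∈ unitaryGroup ι ℂ, ‖(1 - V * X).det‖ ≤ ‖(1 - X).det‖))
    {v : ι → ℂ} (hv : star v ⬝ᵥ v = 1) : (star v ⬝ᵥ (X * (1 - X)⁻¹) *ᵥ v).im = 0 := by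
  set μ := star v ⬝ᵥ (X * (1 - X)⁻¹) *ᵥ v with hμ
  have hn : 0 < ‖(1 - X).det‖ := norm_pos_iff.mpr hX
  have key (z : ℂ) (hz : ‖z‖ = 1) :
      ‖1 - (z - 1) * μ‖ ^ 2 = 1 + 2 * ((star (1 + μ) * μ).re - (star (1 + μ) * μ * z).re) := by
    have h1 : z.re ^ 2 + z.im ^ 2 = 1 := by
      have := Complex.sq_norm z
      rw [Complex.normSq_apply, hz] at this
      linarith
    rw [Complex.sq_norm, Complex.normSq_apply]
    simp
    linear_combination (μ.re ^ 2 + μ.im ^ 2) * h1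
  have hc : (star (1 + μ) * μ).im = 0 := by
    rcases h with h | h
    · refine Complex.im_eq_zero_of_forall_re_mul_le fun z hz => ?_
      have h1 := h _ (lineRotation_mem_unitaryGroup hv hz)
      rw [det_one_sub_lineRotation_mul hX, norm_mul, ← hμ] at h1
      have h2 : 1 ≤ ‖1 - (z - 1) * μ‖ := le_of_mul_le_mul_left (by simpa using h1) hn
      have := key z hz
      nlinarith
    · have : (-(star (1 + μ) * μ)).im = 0 := by
        refine Complex.im_eq_zero_of_forall_re_mul_le fun z hz => ?_
        have h1 := h _ (lineRotation_mem_unitaryGroup hv hz)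
        rw [det_one_sub_lineRotation_mul hX, norm_mul, ← hμ] at h1
        have h2 : ‖1 - (z - 1) * μ‖ ≤ 1 := le_of_mul_le_mul_left (by simpa using h1) hn
        have := key z hz
        rw [neg_mul, Complex.neg_re, Complex.neg_re]
        nlinarith [norm_nonneg (1 - (z - 1) * μ)]
      rwa [Complex.neg_im, neg_eq_zero] at this
  simp at hc
  linarith

lemma isHermitian_of_im_dotProduct_eq_zero {M : Matrix ι ι ℂ}
    (h : ∀ v : ι → ℂ, star v ⬝ᵥ v = 1 → (star v ⬝ᵥ M *ᵥ v).im = 0) : M.IsHermitian := by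
  rw [← isSymmetric_toEuclideanLin_iff, LinearMap.isSymmetric_iff_inner_map_self_real]
  intro v
  suffices H : (star v.ofLp ⬝ᵥ M *ᵥ v.ofLp).im = 0 by
    have h1 : inner ℂ (toEuclideanLin M v) v = star (star v.ofLp ⬝ᵥ M *ᵥ v.ofLp) := by
      rw [EuclideanSpace.inner_eq_star_dotProduct]
      simp [← star_dotProduct_star, dotProduct_comm]
    rw [h1]
    apply Complex.conj_eq_iff_im.mpr
    simpa using H
  by_cases hv : v = 0
  · simp [hv]
  have hn : ‖v‖ ≠ 0 := by simpa using hv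
  have hvv : star v.ofLp ⬝ᵥ v.ofLp = (‖v‖ : ℂ) ^ 2 := by
    rw [dotProduct_comm, ← EuclideanSpace.inner_eq_star_dotProduct]
    exact inner_self_eq_norm_sq_to_K v
  have h1 := h ((‖v‖ : ℂ)⁻¹ • v.ofLp) (by
    rw [star_smul, smul_dotProduct, dotProduct_smul, hvv]
    simp
    field_simp)
  rw [star_smul, mulVec_smul, smul_dotProduct, dotProduct_smul] at h1
  have h2 : star ((‖v‖ : ℂ)⁻¹) • (‖v‖ : ℂ)⁻¹ • (star v.ofLp ⬝ᵥ M *ᵥ v.ofLp)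
      = ((‖v‖⁻¹ ^ 2 : ℝ) : ℂ) * (star v.ofLp ⬝ᵥ M *ᵥ v.ofLp) := by
    simp
    ring
  rw [h2, Complex.im_ofReal_mul] at h1
  simpa [hn] using h1

/-- If `|det (1 - V X)|` is extremal at `V = 1`, among unitary `V`, then `X` is Hermitian. -/
lemma isHermitian_of_extremal {X : Matrix ι ι ℂ} (hX : (1 - X).det ≠ 0)
    (h : (∀ V ∈ unitaryGroup ι ℂ, ‖(1 - X).det‖ ≤ ‖(1 - V * X).det‖) ∨
      (∀ V ∈ unitaryGroup ι ℂ, ‖(1 - V * X).det‖ ≤ ‖(1 - X).det‖)) : X.IsHermitian := by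
  have hu : IsUnit (1 - X).det := hX.isUnit
  have h1 : (X * (1 - X)⁻¹).IsHermitian :=
    isHermitian_of_im_dotProduct_eq_zero fun v hv => im_dotProduct_eq_zero_of_extremal hX h hv
  -- This identity carries Hermitianness from `X (1 - X)⁻¹` to the resolvent, and inversion carries
  -- it on to `X`.
  have h2 : (1 - X)⁻¹ = X * (1 - X)⁻¹ + 1 := by
    have := mul_nonsing_inv _ hu
    rw [sub_mul, one_mul, sub_eq_iff_eq_add] at this
    rw [add_comm]; exact this
  have h3 : ((1 - X)⁻¹).IsHermitian := by
    rw [h2]; exact h1.add isHermitian_one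
  have h4 : (1 - X).IsHermitian := by
    have := h3.inv
    rwa [nonsing_inv_nonsing_inv _ hu] at this
  have := isHermitian_one.sub h4
  simpa using this

/-! ### Compactness and unitary diagonalization -/

lemma isCompact_unitaryGroup : IsCompact (unitaryGroup ι ℂ : Set (Matrix ι ι ℂ)) := by
  refine IsCompact.of_isClosed_subset
    (isCompact_univ_pi fun _ : ι => isCompact_univ_pi fun _ : ι =>
      isCompact_closedBall (0 : ℂ) 1) isClosed_unitary ?_
  intro U hU i _ j _
  simpa using entry_norm_bound_of_unitary hU i j

lemma norm_prod_one_sub_ofReal {ι : Type*} [Fintype ι] {a : ι → ℝ} (h : ∀ k, |a k| < 1) :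
    ‖∏ k, (1 - (a k : ℂ))‖ = ∏ k, (1 - a k) := by
  rw [norm_prod]
  refine Finset.prod_congr rfl fun k _ => ?_
  rw [← Complex.ofReal_one, ← Complex.ofReal_sub, Complex.norm_real, Real.norm_eq_abs, abs_of_pos]
  linarith [(abs_lt.mp (h k)).2]

lemma IsHermitian.exists_unitary_mul_diagonal_mul_star {A : Matrix ι ι ℂ} (hA : A.IsHermitian) :
    ∃ P ∈ unitaryGroup ι ℂ, A = P * diagonal (fun k => (hA.eigenvalues k : ℂ)) * star P :=
  ⟨hA.eigenvectorUnitary, hA.eigenvectorUnitary.2, hA.spectral_theorem⟩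

lemma one_sub_unitary_conj_diagonal {P : Matrix ι ι ℂ} (hP : P ∈ unitaryGroup ι ℂ) (d : ι → ℂ) :
    1 - P * diagonal d * star P = P * diagonal (fun k => 1 - d k) * star P := by
  have : diagonal (fun k => 1 - d k) = 1 - diagonal d := by
    rw [← diagonal_one, diagonal_sub]
  rw [this, mul_sub, sub_mul, mul_one, mem_unitaryGroup_iff.mp hP]

lemma det_unitary_conj {P : Matrix ι ι ℂ} (hP : P ∈ unitaryGroup ι ℂ) (A : Matrix ι ι ℂ) :
    (P * A * star P).det = A.det := by
  rw [det_mul_right_comm, mem_unitaryGroup_iff.mp hP, one_mul]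

lemma det_one_sub_unitary_conj_diagonal {P : Matrix ι ι ℂ} (hP : P ∈ unitaryGroup ι ℂ)
    (d : ι → ℂ) : (1 - P * diagonal d * star P).det = ∏ k, (1 - d k) := by
  rw [one_sub_unitary_conj_diagonal hP, det_unitary_conj hP, det_diagonal]

lemma det_one_add_unitary_conj_diagonal {P : Matrix ι ι ℂ} (hP : P ∈ unitaryGroup ι ℂ)
    (d : ι → ℂ) : (1 + P * diagonal d * star P).det = ∏ k, (1 + d k) := by
  have := det_one_sub_unitary_conj_diagonal hP (fun k => - d k)
  rw [← diagonal_neg, mul_neg, neg_mul] at this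
  simpa using this

lemma isUnit_of_mem_unitaryGroup {P : Matrix ι ι ℂ} (hP : P ∈ unitaryGroup ι ℂ) : IsUnit P :=
  IsUnit.of_mul_eq_one _ (mem_unitaryGroup_iff.mp hP)

lemma posDef_unitary_conj_diagonal_iff {P : Matrix ι ι ℂ} (hP : P ∈ unitaryGroup ι ℂ)
    (d : ι → ℝ) :
    (P * diagonal (fun k => (d k : ℂ)) * star P).PosDef ↔ ∀ k, 0 < d k := by
  rw [Matrix.IsUnit.posDef_star_right_conjugate_iff (isUnit_of_mem_unitaryGroup hP),
    posDef_diagonal_iff]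
  simp

lemma unitary_conj_diagonal_mul {P : Matrix ι ι ℂ} (hP : P ∈ unitaryGroup ι ℂ) (d e : ι → ℂ) :
    (P * diagonal d * star P) * (P * diagonal e * star P) =
      P * diagonal (fun k => d k * e k) * star P := by
  rw [← diagonal_mul_diagonal]
  calc _ = P * diagonal d * (star P * P) * diagonal e * star P := by simp only [mul_assoc]
    _ = _ := by rw [mem_unitaryGroup_iff'.mp hP, mul_one]; simp only [mul_assoc]

open scoped MatrixOrder in
lemma PosSemidef.eq_of_mul_self_eq {A B : Matrix ι ι ℂ} (hA : A.PosSemidef) (hB : B.PosSemidef)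
    (h : A * A = B * B) : A = B := by
  rw [← sq, ← sq] at h
  exact (CFC.sq_eq_sq_iff A B hA.nonneg hB.nonneg).mp h

/-- A Hermitian matrix and its absolute value are simultaneously diagonalizable. -/
lemma exists_diagonalization_of_mul_self_eq {X W : Matrix ι ι ℂ} (hX : X.IsHermitian)
    (hW : W.PosSemidef) (h : X * X = W * W) :
    ∃ P ∈ unitaryGroup ι ℂ, ∃ a : ι → ℝ, X = P * diagonal (fun k => (a k : ℂ)) * star P ∧
      W = P * diagonal (fun k => ((|a k| : ℝ) : ℂ)) * star P := by
  obtain ⟨P, hP, hXP⟩ := hX.exists_unitary_mul_diagonal_mul_star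
  refine ⟨P, hP, hX.eigenvalues, hXP, hW.eq_of_mul_self_eq ?_ ?_⟩
  · exact (posSemidef_diagonal_iff.mpr fun k => by simp).mul_mul_conjTranspose_same P
  · rw [← h, unitary_conj_diagonal_mul hP]
    conv_lhs => rw [hXP, unitary_conj_diagonal_mul hP]
    simp only [← Complex.ofReal_mul, abs_mul_abs_self]

/-- A vector fixed by `U W` satisfies `‖v‖ = ‖W v‖`, which positive definiteness of `1 - W²`
excludes unless `v = 0`. -/
lemma det_one_sub_unitary_mul_ne_zero {U W : Matrix ι ι ℂ} (hU : U ∈ unitaryGroup ι ℂ)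
    (hW : W.PosSemidef) (hW1 : (1 - W).PosDef) : (1 - U * W).det ≠ 0 := by
  intro h0
  obtain ⟨v, hv, hv0⟩ := exists_mulVec_eq_zero_iff.mpr h0
  have hpd : (1 - W * W).PosDef := by
    obtain ⟨P, hP, hWP⟩ := hW.1.exists_unitary_mul_diagonal_mul_star
    have h1 := hW1
    rw [hWP, one_sub_unitary_conj_diagonal hP] at h1
    have h2 := (posDef_unitary_conj_diagonal_iff hP (fun k => 1 - hW.1.eigenvalues k)).mp
      (by simpa using h1)
    rw [hWP, unitary_conj_diagonal_mul hP, one_sub_unitary_conj_diagonal hP]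
    have := (posDef_unitary_conj_diagonal_iff hP
      (fun k => 1 - hW.1.eigenvalues k * hW.1.eigenvalues k)).mpr
      (fun k => by nlinarith [h2 k, hW.eigenvalues_nonneg k])
    simpa using this
  have hvU : v = (U * W) *ᵥ v := by
    rw [sub_mulVec, one_mulVec, sub_eq_zero] at hv0
    exact hv0
  have hvv : star v ⬝ᵥ v = star v ⬝ᵥ (W * W) *ᵥ v := by
    calc star v ⬝ᵥ v = star ((U * W) *ᵥ v) ⬝ᵥ (U * W) *ᵥ v := by rw [← hvU]
      _ = star v ⬝ᵥ ((U * W)ᴴ * (U * W)) *ᵥ v := by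
        rw [star_mulVec, ← dotProduct_mulVec, mulVec_mulVec]
      _ = _ := by
        rw [conjTranspose_mul, hW.1.eq, mul_assoc, ← mul_assoc Uᴴ, ← star_eq_conjTranspose,
          mem_unitaryGroup_iff'.mp hU, one_mul]
  have := hpd.dotProduct_mulVec_pos hv
  rw [sub_mulVec, one_mulVec, dotProduct_sub, hvv, sub_self] at this
  exact lt_irrefl _ this

/-! ### Determinant bounds over the unitary group -/

/-- At an extremum of `|det (1 - U W)|` over unitary `U`, the matrices `U W` and `W` are
simultaneously diagonalizable, with the eigenvalues of `W` the absolute values of those of `U W`. -/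
lemma exists_diagonalization_of_extremal {U W : Matrix ι ι ℂ} (hU : U ∈ unitaryGroup ι ℂ)
    (hW : W.PosSemidef) (hW1 : (1 - W).PosDef)
    (h : (∀ V ∈ unitaryGroup ι ℂ, ‖(1 - U * W).det‖ ≤ ‖(1 - V * W).det‖) ∨
      (∀ V ∈ unitaryGroup ι ℂ, ‖(1 - V * W).det‖ ≤ ‖(1 - U * W).det‖)) :
    ∃ P ∈ unitaryGroup ι ℂ, ∃ a : ι → ℝ, (∀ k, |a k| < 1) ∧
      U * W = P * diagonal (fun k => (a k : ℂ)) * star P ∧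
      W = P * diagonal (fun k => ((|a k| : ℝ) : ℂ)) * star P := by
  have hX : (U * W).IsHermitian := by
    refine isHermitian_of_extremal (det_one_sub_unitary_mul_ne_zero hU hW hW1) ?_
    refine h.imp (fun h V hV => ?_) (fun h V hV => ?_) <;>
    · rw [← mul_assoc]
      exact h _ (mul_mem hV hU)
  have hsq : (U * W) * (U * W) = W * W := by
    nth_rw 1 [← hX.eq]
    rw [conjTranspose_mul, hW.1.eq, mul_assoc, ← mul_assoc Uᴴ, ← star_eq_conjTranspose,
      mem_unitaryGroup_iff'.mp hU, one_mul]
  obtain ⟨P, hP, a, hXa, hWa⟩ := exists_diagonalization_of_mul_self_eq hX hW hsq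
  refine ⟨P, hP, a, fun k => ?_, hXa, hWa⟩
  rw [hWa, one_sub_unitary_conj_diagonal hP] at hW1
  have := (posDef_unitary_conj_diagonal_iff hP (fun k => 1 - |a k|)).mp (by simpa using hW1) k
  linarith

lemma _root_.Finset.eq_of_prod_eq_of_le {α : Type*} {s : Finset α} {f g : α → ℝ}
    (hf : ∀ i ∈ s, 0 < f i) (hfg : ∀ i ∈ s, f i ≤ g i) (h : ∏ i ∈ s, f i = ∏ i ∈ s, g i) :
    ∀ i ∈ s, f i = g i := by
  by_contra! hne
  obtain ⟨i, hi, hne⟩ := hne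
  exact (Finset.prod_lt_prod hf hfg ⟨i, hi, lt_of_le_of_ne (hfg i hi) hne⟩).ne h

lemma continuous_norm_det_one_sub_mul (W : Matrix ι ι ℂ) :
    Continuous fun V : Matrix ι ι ℂ => ‖(1 - V * W).det‖ := by
  have : Continuous fun V : Matrix ι ι ℂ => (1 - V * W) := by fun_prop
  exact this.matrix_det.norm

theorem norm_det_one_sub_le {U W : Matrix ι ι ℂ} (hU : U ∈ unitaryGroup ι ℂ)
    (hW : W.PosSemidef) (hW1 : (1 - W).PosDef) :
    ‖(1 - W).det‖ ≤ ‖(1 - U * W).det‖ ∧ (‖(1 - W).det‖ = ‖(1 - U * W).det‖ → U * W = W) := by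
  have main : ∀ V ∈ unitaryGroup ι ℂ,
      (∀ V' ∈ unitaryGroup ι ℂ, ‖(1 - V * W).det‖ ≤ ‖(1 - V' * W).det‖) →
      ‖(1 - W).det‖ ≤ ‖(1 - V * W).det‖ ∧
        (‖(1 - W).det‖ = ‖(1 - V * W).det‖ → V * W = W) := by
    intro V hV hmin
    obtain ⟨P, hP, a, ha, hX, hWa⟩ := exists_diagonalization_of_extremal hV hW hW1 (.inl hmin)
    have e1 : ‖(1 - V * W).det‖ = ∏ k, (1 - a k) := by
      rw [hX, det_one_sub_unitary_conj_diagonal hP, norm_prod_one_sub_ofReal ha]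
    have e2 : ‖(1 - W).det‖ = ∏ k, (1 - |a k|) := by
      rw [hWa, det_one_sub_unitary_conj_diagonal hP,
        norm_prod_one_sub_ofReal (a := fun k => |a k|) (by simpa using ha)]
    have h0 : ∀ k ∈ Finset.univ, 0 < 1 - |a k| := fun k _ => by linarith [ha k]
    have h1 : ∀ k ∈ Finset.univ, 1 - |a k| ≤ 1 - a k := fun k _ => by linarith [le_abs_self (a k)]
    rw [e1, e2]
    refine ⟨Finset.prod_le_prod (fun k hk => (h0 k hk).le) h1, fun h => ?_⟩
    have h2 := Finset.eq_of_prod_eq_of_le h0 h1 h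
    have h3 : ∀ k, a k = |a k| := fun k => by linarith [h2 k (Finset.mem_univ k)]
    conv_rhs => rw [hWa]
    rw [hX]
    simp only [← h3]
  obtain ⟨V, hV, hmin⟩ := isCompact_unitaryGroup.exists_isMinOn ⟨1, one_mem (unitaryGroup ι ℂ)⟩
    (continuous_norm_det_one_sub_mul W).continuousOn
  have hle := (main V hV fun V' hV' => hmin hV').1
  -- Equality makes `U` itself a minimizer, so the analysis of minimizers applies to it.
  refine ⟨hle.trans (hmin hU), fun h => (main U hU fun V' hV' => ?_).2 h⟩
  rw [← h]
  exact hle.trans (hmin hV')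

theorem norm_det_one_sub_le_one_add {U W : Matrix ι ι ℂ} (hU : U ∈ unitaryGroup ι ℂ)
    (hW : W.PosSemidef) (hW1 : (1 - W).PosDef) :
    ‖(1 - U * W).det‖ ≤ ‖(1 + W).det‖ ∧ (‖(1 - U * W).det‖ = ‖(1 + W).det‖ → U * W = -W) := by
  have main : ∀ V ∈ unitaryGroup ι ℂ,
      (∀ V' ∈ unitaryGroup ι ℂ, ‖(1 - V' * W).det‖ ≤ ‖(1 - V * W).det‖) →
      ‖(1 - V * W).det‖ ≤ ‖(1 + W).det‖ ∧
        (‖(1 - V * W).det‖ = ‖(1 + W).det‖ → V * W = -W) := by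
    intro V hV hmax
    obtain ⟨P, hP, a, ha, hX, hWa⟩ := exists_diagonalization_of_extremal hV hW hW1 (.inr hmax)
    have e1 : ‖(1 - V * W).det‖ = ∏ k, (1 - a k) := by
      rw [hX, det_one_sub_unitary_conj_diagonal hP, norm_prod_one_sub_ofReal ha]
    have e2 : ‖(1 + W).det‖ = ∏ k, (1 + |a k|) := by
      have := norm_prod_one_sub_ofReal (a := fun k => -|a k|) (by simpa using ha)
      rw [hWa, det_one_add_unitary_conj_diagonal hP]
      simpa using this
    have h0 : ∀ k ∈ Finset.univ, 0 < 1 - a k := fun k _ => by linarith [(abs_lt.mp (ha k)).2]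
    have h1 : ∀ k ∈ Finset.univ, 1 - a k ≤ 1 + |a k| := fun k _ => by linarith [neg_abs_le (a k)]
    rw [e1, e2]
    refine ⟨Finset.prod_le_prod (fun k hk => (h0 k hk).le) h1, fun h => ?_⟩
    have h2 := Finset.eq_of_prod_eq_of_le h0 h1 h
    have h3 : ∀ k, |a k| = -a k := fun k => by linarith [h2 k (Finset.mem_univ k)]
    conv_rhs => rw [hWa]
    rw [hX]
    simp only [h3, Complex.ofReal_neg]
    rw [← diagonal_neg, mul_neg, neg_mul, neg_neg]
  obtain ⟨V, hV, hmax⟩ := isCompact_unitaryGroup.exists_isMaxOn ⟨1, one_mem (unitaryGroup ι ℂ)⟩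
    (continuous_norm_det_one_sub_mul W).continuousOn
  have hle := (main V hV fun V' hV' => hmax hV').1
  refine ⟨(hmax hU : _ ≤ _).trans hle, fun h => (main U hU fun V' hV' => ?_).2 h⟩
  rw [h]
  exact (hmax hV' : _ ≤ _).trans hle

/-! ### Jensen's inequality for traces -/

/-- Trace form of Jensen's inequality for a strictly convex function, with its equality case. -/
theorem sum_strictConvexOn_eigenvalues_le {m : Type*} [Fintype m]
    {s : Set ℝ} {g : ℝ → ℝ} (hg : StrictConvexOn ℝ s g)
    {w : m → ℝ} (hw : ∀ i, 0 < w i) (hw1 : ∑ i, w i = 1)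
    {Z : m → Matrix ι ι ℂ} (hZ : ∀ i, (Z i).IsHermitian)
    (hs : ∀ i k, (hZ i).eigenvalues k ∈ s)
    {W : Matrix ι ι ℂ} (hW : W.IsHermitian) (hWZ : W = ∑ i, (w i : ℂ) • Z i) :
    (∀ k, hW.eigenvalues k ∈ s) ∧
    ∑ k, g (hW.eigenvalues k) ≤ ∑ i, w i * ∑ k, g ((hZ i).eigenvalues k) ∧
    (∑ k, g (hW.eigenvalues k) = ∑ i, w i * ∑ k, g ((hZ i).eigenvalues k) → ∀ i, Z i = W) := by
  obtain ⟨P, hP, hWP⟩ := hW.exists_unitary_mul_diagonal_mul_star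
  choose Q hQ hZQ using fun i => (hZ i).exists_unitary_mul_diagonal_mul_star
  set lam := hW.eigenvalues
  set r := fun i => (hZ i).eigenvalues
  change (∀ i k, r i k ∈ s) at hs
  change ∀ i, Z i = Q i * diagonal (fun k => (r i k : ℂ)) * star (Q i) at hZQ
  change _ ∧ _ ≤ ∑ i, w i * ∑ k, g (r i k) ∧ (_ = ∑ i, w i * ∑ k, g (r i k) → _)
  set T := fun i => star P * Q i
  have hT : ∀ i, T i ∈ unitaryGroup ι ℂ := fun i => mul_mem (Unitary.star_mem hP) (hQ i)
  have hPP := mem_unitaryGroup_iff'.mp hP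
  have hPP' := mem_unitaryGroup_iff.mp hP
  have hZT : ∀ i, star P * Z i * P = T i * diagonal (fun k => (r i k : ℂ)) * star (T i) := by
    intro i
    rw [hZQ i, star_mul, star_star]
    simp only [T, mul_assoc]
  have hWT : star P * W * P = diagonal (fun k => (lam k : ℂ)) := by
    rw [hWP]
    calc _ = (star P * P) * diagonal (fun k => (lam k : ℂ)) * (star P * P) := by
          simp only [mul_assoc]
      _ = _ := by rw [hPP, one_mul, mul_one]
  have hrow : ∀ i k, ∑ l, ‖T i k l‖ ^ 2 = 1 := by
    intro i k
    have h := congrFun (congrFun (mem_unitaryGroup_iff.mp (hT i)) k) k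
    rw [mul_apply, one_apply_eq] at h
    have h' : ((∑ l, ‖T i k l‖ ^ 2 : ℝ) : ℂ) = 1 := by
      rw [← h]
      push_cast
      exact Finset.sum_congr rfl fun l _ => by
        rw [star_apply]; exact (Complex.mul_conj' _).symm
    exact_mod_cast h'
  have hcol : ∀ i l, ∑ k, ‖T i k l‖ ^ 2 = 1 := by
    intro i l
    have h := congrFun (congrFun (mem_unitaryGroup_iff'.mp (hT i)) l) l
    rw [mul_apply, one_apply_eq] at h
    have h' : ((∑ k, ‖T i k l‖ ^ 2 : ℝ) : ℂ) = 1 := by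
      rw [← h]
      push_cast
      exact Finset.sum_congr rfl fun k _ => by
        rw [star_apply]; exact (Complex.conj_mul' _).symm
    exact_mod_cast h'
  -- In the eigenbasis of `W`, its diagonal entries are convex combinations of all the `r i l`. The
  -- weights sum to one over `p` since the rows of `T i` are unit vectors; unit columns give `hsum`.
  let c : ι → m × ι → ℝ := fun k p => w p.1 * ‖T p.1 k p.2‖ ^ 2
  have hc0 : ∀ k, ∀ p ∈ (Finset.univ : Finset (m × ι)), 0 ≤ c k p := fun k p _ =>
    mul_nonneg (hw _).le (sq_nonneg _)
  have hc1 : ∀ k, ∑ p, c k p = 1 := by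
    intro k
    simp only [c, Fintype.sum_prod_type, ← Finset.mul_sum, hrow, mul_one, hw1]
  have hmem : ∀ p ∈ (Finset.univ : Finset (m × ι)), r p.1 p.2 ∈ s := fun p _ => hs _ _
  have hlam : ∀ k, lam k = ∑ p, c k p • r p.1 p.2 := by
    intro k
    have h := congrFun (congrFun hWT k) k
    rw [hWZ, Finset.mul_sum, Finset.sum_mul, diagonal_apply_eq, sum_apply] at h
    have h' : (lam k : ℂ) = ((∑ p, c k p • r p.1 p.2 : ℝ) : ℂ) := by
      rw [← h, Fintype.sum_prod_type]
      push_cast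
      refine Finset.sum_congr rfl fun i _ => ?_
      rw [mul_smul_comm, smul_mul_assoc, hZT, smul_apply, mul_apply, smul_eq_mul, Finset.mul_sum]
      refine Finset.sum_congr rfl fun l _ => ?_
      rw [mul_diagonal, star_apply]
      have := Complex.mul_conj' (T i k l)
      simp only [c, smul_eq_mul, Complex.star_def]
      push_cast
      rw [← this]
      ring
    exact_mod_cast h'
  have hsum : ∑ k, ∑ p, c k p • g (r p.1 p.2) = ∑ i, w i * ∑ k, g (r i k) := by
    rw [Finset.sum_comm, Fintype.sum_prod_type]
    refine Finset.sum_congr rfl fun i _ => ?_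
    rw [Finset.mul_sum]
    refine Finset.sum_congr rfl fun l _ => ?_
    simp only [c, smul_eq_mul]
    rw [← Finset.sum_mul, ← Finset.mul_sum, hcol, mul_one]
  have hle : ∀ k ∈ Finset.univ, g (lam k) ≤ ∑ p, c k p • g (r p.1 p.2) := fun k _ => by
    rw [hlam k]
    exact hg.convexOn.map_sum_le (hc0 k) (hc1 k) hmem
  refine ⟨fun k => ?_, ?_, fun heq i => ?_⟩
  · rw [hlam k]
    exact hg.1.sum_mem (hc0 k) (hc1 k) hmem
  · rw [← hsum]
    exact Finset.sum_le_sum hle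
  · rw [← hsum, Finset.sum_eq_sum_iff_of_le hle] at heq
    -- By strict convexity all points of nonzero weight coincide with their mean, so `T i`
    -- intertwines the two diagonal matrices.
    have hdiag : ∀ k l, T i k l ≠ 0 → r i l = lam k := by
      intro k l hne
      have h := heq k (Finset.mem_univ k)
      rw [hlam k, hg.map_sum_eq_iff' (hc0 k) (hc1 k) hmem, ← hlam k] at h
      exact h (i, l) (Finset.mem_univ _) (mul_pos (hw i) (by positivity)).ne'
    have hcomm : T i * diagonal (fun k => (r i k : ℂ)) = diagonal (fun k => (lam k : ℂ)) * T i := by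
      ext k l
      rw [mul_diagonal, diagonal_mul]
      by_cases h : T i k l = 0
      · simp [h]
      · rw [hdiag k l h, mul_comm]
    have h1 : star P * Z i * P = star P * W * P := by
      rw [hZT, hcomm, mul_assoc, mem_unitaryGroup_iff.mp (hT i), mul_one, hWT]
    calc Z i = (P * star P) * Z i * (P * star P) := by rw [hPP', one_mul, mul_one]
      _ = P * (star P * Z i * P) * star P := by simp only [mul_assoc]
      _ = (P * star P) * W * (P * star P) := by rw [h1]; simp only [mul_assoc]
      _ = W := by rw [hPP', one_mul, mul_one]

end Matrix

/-! ### The convex function, spectra and products -/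

/-- The function `log ((1 + x) / (1 - x))` is strictly convex on `[0, 1)`. -/
lemma strictConvexOn_log_one_add_sub_log_one_sub :
    StrictConvexOn ℝ (Set.Ico 0 1) fun x : ℝ => Real.log (1 + x) - Real.log (1 - x) := by
  have hderiv : ∀ x ∈ Set.Ioo (0 : ℝ) 1,
      deriv (fun x : ℝ => Real.log (1 + x) - Real.log (1 - x)) x = 2 / (1 - x ^ 2) := by
    intro x hx
    have h1 : 1 + x ≠ 0 := by linarith [hx.1]
    have h2 : 1 - x ≠ 0 := by linarith [hx.2]
    have h3 := (((hasDerivAt_id x).const_add 1).log h1).sub (((hasDerivAt_id x).const_sub 1).log h2)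
    have h4 : 1 - x ^ 2 ≠ 0 := by
      rw [show 1 - x ^ 2 = (1 + x) * (1 - x) by ring]; exact mul_ne_zero h1 h2
    refine HasDerivAt.deriv (h3.congr_deriv ?_)
    simp only [id]
    field_simp
    ring
  refine StrictMonoOn.strictConvexOn_of_deriv (convex_Ico 0 1) ?_ ?_
  · refine ContinuousOn.sub (ContinuousOn.log (by fun_prop) fun x hx => ?_)
      (ContinuousOn.log (by fun_prop) fun x hx => ?_)
    · linarith [hx.1]
    · linarith [hx.2]
  · rw [interior_Ico]
    intro x hx y hy hxy
    rw [hderiv x hx, hderiv y hy]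
    have : 0 < 1 - y ^ 2 := by nlinarith [hy.1, hy.2]
    have : x ^ 2 < y ^ 2 := by nlinarith [hx.1]
    gcongr

lemma eq_map_eigenvalues_of_spec_eq {n : ℕ} {A : Matrix (Fin n) (Fin n) ℂ} (hA : A.IsHermitian)
    {r : Fin n → ℝ} (hr : Spec A = Finset.univ.val.map (fun k => (r k : ℂ))) :
    Finset.univ.val.map hA.eigenvalues = Finset.univ.val.map r := by
  have h := hA.roots_charpoly_eq_eigenvalues
  rw [Spec] at hr
  rw [hr] at h
  have := congrArg (Multiset.map Complex.re) h
  simpa [Multiset.map_map, Function.comp_def] using this.symm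

lemma charpoly_eq_of_spec_eq {n : ℕ} {A B : Matrix (Fin n) (Fin n) ℂ} (h : Spec A = Spec B) :
    A.charpoly = B.charpoly := by
  rw [(IsAlgClosed.splits A.charpoly).eq_prod_roots_of_monic A.charpoly_monic,
    (IsAlgClosed.splits B.charpoly).eq_prod_roots_of_monic B.charpoly_monic]
  rw [Spec, Spec] at h
  rw [h]

/-- Over `ℂ` the characteristic polynomial is determined by its roots; evaluate it at `1`. -/
lemma det_one_sub_eq_of_spec_eq {n : ℕ} {A B : Matrix (Fin n) (Fin n) ℂ} (h : Spec A = Spec B) :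
    (1 - A).det = (1 - B).det := by
  have := congrArg (Polynomial.eval 1) (charpoly_eq_of_spec_eq h)
  simpa [Matrix.eval_charpoly] using this

lemma prod_prod_rpow_eq_exp {m n : ℕ} {r : Fin m → Fin n → ℝ} (hr : ∀ i k, 0 ≤ r i k ∧ r i k < 1)
    (w : Fin m → ℝ) :
    ∏ k, ∏ i, ((1 + r i k) / (1 - r i k)) ^ w i =
      Real.exp (∑ i, w i * ∑ k, (Real.log (1 + r i k) - Real.log (1 - r i k))) := by
  simp only [Finset.mul_sum]
  rw [Finset.sum_comm, Real.exp_sum]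
  refine Finset.prod_congr rfl fun k _ => ?_
  rw [Real.exp_sum]
  refine Finset.prod_congr rfl fun i _ => ?_
  have h1 : 0 < 1 + r i k := by linarith [(hr i k).1]
  have h2 : 0 < 1 - r i k := by linarith [(hr i k).2]
  rw [← Real.log_div h1.ne' h2.ne', Real.rpow_def_of_pos (div_pos h1 h2), mul_comm]

lemma prod_prod_rpow_inv {m n : ℕ} {r : Fin m → Fin n → ℝ} (hr : ∀ i k, 0 ≤ r i k ∧ r i k < 1)
    (w : Fin m → ℝ) :
    ∏ k, ∏ i, ((1 - r i k) / (1 + r i k)) ^ w i =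
      (∏ k, ∏ i, ((1 + r i k) / (1 - r i k)) ^ w i)⁻¹ := by
  simp only [← Finset.prod_inv_distrib]
  refine Finset.prod_congr rfl fun k _ => Finset.prod_congr rfl fun i _ => ?_
  have h1 : 0 < 1 + r i k := by linarith [(hr i k).1]
  have h2 : 0 < 1 - r i k := by linarith [(hr i k).2]
  rw [← Real.inv_rpow (div_pos h1 h2).le, inv_div]

/-! ### Assembling the two-sided bound -/

/-- Bounds on `a b / d²` for `a ≤ d ≤ b` and `b / a ≤ R`, with the equality cases. -/
lemma mul_div_sq_bounds {a b d R : ℝ} (ha : 0 < a) (had : a ≤ d) (hdb : d ≤ b) (hR : b / a ≤ R) :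
    R⁻¹ ≤ a * b / d ^ 2 ∧ a * b / d ^ 2 ≤ R ∧
    (R⁻¹ = a * b / d ^ 2 ↔ d = b ∧ b / a = R) ∧ (a * b / d ^ 2 = R ↔ a = d ∧ b / a = R) := by
  have hd : 0 < d := ha.trans_le had
  have hb : 0 < b := hd.trans_le hdb
  have hba : 0 < b / a := div_pos hb ha
  have hR0 : 0 < R := hba.trans_le hR
  have h1 : R⁻¹ ≤ (b / a)⁻¹ := inv_anti₀ hba hR
  have e2 : (b / a)⁻¹ = a * b / b ^ 2 := by field_simp
  have e3 : b / a = a * b / a ^ 2 := by field_simp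
  have h2 : a * b / b ^ 2 ≤ a * b / d ^ 2 := by gcongr
  have h3 : a * b / d ^ 2 ≤ a * b / a ^ 2 := by gcongr
  have cancel : ∀ x y : ℝ, 0 < x → 0 < y → a * b / x ^ 2 = a * b / y ^ 2 → x = y := by
    intro x y hx hy h
    rw [div_eq_div_iff (by positivity) (by positivity)] at h
    have := mul_left_cancel₀ (mul_pos ha hb).ne' h
    exact ((sq_eq_sq₀ hy.le hx.le).mp this).symm
  refine ⟨h1.trans (e2.trans_le h2), h3.trans (e3.symm.trans_le hR), ⟨fun h => ?_, ?_⟩,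
    ⟨fun h => ?_, ?_⟩⟩
  -- Equality of the ends of `R⁻¹ ≤ a / b ≤ a b / d²` forces equality in both links.
  · exact ⟨cancel d b hd hb (le_antisymm (by linarith) h2),
      inv_injective (le_antisymm (by linarith) h1)⟩
  · rintro ⟨rfl, rfl⟩; exact e2
  · exact ⟨cancel a d ha hd (le_antisymm (by linarith) h3), le_antisymm hR (by linarith)⟩
  · rintro ⟨rfl, rfl⟩; exact e3.symm

theorem theorem5 {m n : ℕ}
    (Z : Fin m → Matrix (Fin n) (Fin n) ℂ) (hZ : ∀ i, (Z i).PosSemidef)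
    -- `r i 0, …, r i (n-1)` are the eigenvalues of `Z i`, in any order
    (r : Fin m → Fin n → ℝ)
    (hr : ∀ i, Spec (Z i) = Finset.univ.val.map (fun k : Fin n => (r i k : ℂ)))
    (hr01 : ∀ i k, 0 ≤ r i k ∧ r i k < 1)
    (w : Fin m → ℝ) (hw : ∀ i, 0 < w i) (hw1 : ∑ i, w i = 1)
    (W : Matrix (Fin n) (Fin n) ℂ) (hW : W = ∑ i, (w i : ℂ) • Z i)
    (U : Matrix (Fin n) (Fin n) ℂ) (hU : U ∈ Matrix.unitaryGroup (Fin n) ℂ) :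
    -- the quotient is well defined
    (1 - U * W).det ≠ 0 ∧
    -- the two inequalities, in the order of `ℂ`: they say that the quotient is real as well
    ((∏ k, ∏ i, ((1 - r i k) / (1 + r i k)) ^ w i : ℝ) : ℂ)
        ≤ (1 - W ^ 2).det / ((‖(1 - U * W).det‖ ^ 2 : ℝ) : ℂ) ∧
    (1 - W ^ 2).det / ((‖(1 - U * W).det‖ ^ 2 : ℝ) : ℂ)
        ≤ ((∏ k, ∏ i, ((1 + r i k) / (1 - r i k)) ^ w i : ℝ) : ℂ) ∧
    -- equality on the left
    (((∏ k, ∏ i, ((1 - r i k) / (1 + r i k)) ^ w i : ℝ) : ℂ)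
          = (1 - W ^ 2).det / ((‖(1 - U * W).det‖ ^ 2 : ℝ) : ℂ) ↔
      ∃ Z₀ : Matrix (Fin n) (Fin n) ℂ, (∀ i, Z i = Z₀) ∧
        (1 ∈ Spec Z₀ ∨ Spec (U * Z₀) = Spec (-Z₀))) ∧
    (((∏ k, ∏ i, ((1 - r i k) / (1 + r i k)) ^ w i : ℝ) : ℂ)
          = (1 - W ^ 2).det / ((‖(1 - U * W).det‖ ^ 2 : ℝ) : ℂ) →
      ∀ Z₀ : Matrix (Fin n) (Fin n) ℂ, (∀ i, Z i = Z₀) → IsUnit Z₀ → U = -1) ∧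
    -- equality on the right
    ((1 - W ^ 2).det / ((‖(1 - U * W).det‖ ^ 2 : ℝ) : ℂ)
          = ((∏ k, ∏ i, ((1 + r i k) / (1 - r i k)) ^ w i : ℝ) : ℂ) ↔
      ∃ Z₀ : Matrix (Fin n) (Fin n) ℂ, (∀ i, Z i = Z₀) ∧ Spec (U * Z₀) = Spec Z₀) ∧
    ((1 - W ^ 2).det / ((‖(1 - U * W).det‖ ^ 2 : ℝ) : ℂ)
          = ((∏ k, ∏ i, ((1 + r i k) / (1 - r i k)) ^ w i : ℝ) : ℂ) →
      ∀ Z₀ : Matrix (Fin n) (Fin n) ℂ, (∀ i, Z i = Z₀) → IsUnit Z₀ → U = 1) := by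
  have hm : Nonempty (Fin m) := by
    by_contra h
    rw [not_nonempty_iff] at h
    simp at hw1
  set g : ℝ → ℝ := fun x => Real.log (1 + x) - Real.log (1 - x) with hg
  have hmap := fun i => eq_map_eigenvalues_of_spec_eq (hZ i).1 (hr i)
  -- Only symmetric sums of the eigenvalues enter, so the ordering of `r i` is immaterial.
  have hsum : ∀ i, ∑ k, g ((hZ i).1.eigenvalues k) = ∑ k, g (r i k) := by
    intro i
    have := congrArg (fun s : Multiset ℝ => (s.map g).sum) (hmap i)
    rwa [Multiset.map_map, Multiset.map_map] at this
  have hmem : ∀ i k, (hZ i).1.eigenvalues k ∈ Set.Ico (0 : ℝ) 1 := by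
    intro i k
    have h1 : (hZ i).1.eigenvalues k ∈ Finset.univ.val.map (r i) := by
      rw [← hmap i]
      exact Multiset.mem_map_of_mem _ (Finset.mem_univ k)
    obtain ⟨l, -, hl⟩ := Multiset.mem_map.mp h1
    rw [← hl]
    exact hr01 i l
  have hWpsd : W.PosSemidef := by
    rw [hW]
    refine Matrix.posSemidef_sum _ fun i _ => (hZ i).smul ?_
    exact_mod_cast (hw i).le
  obtain ⟨hlam, hjen, hjeneq⟩ := Matrix.sum_strictConvexOn_eigenvalues_le
    strictConvexOn_log_one_add_sub_log_one_sub hw hw1 (fun i => (hZ i).1) hmem hWpsd.1 hW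
  change ∑ k, g _ ≤ ∑ i, w i * ∑ k, g ((hZ i).1.eigenvalues k) at hjen
  change ∑ k, g _ = ∑ i, w i * ∑ k, g ((hZ i).1.eigenvalues k) → _ at hjeneq
  simp only [hsum] at hjen hjeneq
  obtain ⟨P, hP, hWP⟩ := hWpsd.1.exists_unitary_mul_diagonal_mul_star
  set lam := hWpsd.1.eigenvalues
  have hlam1 : ∀ k, 0 < 1 - lam k := fun k => by linarith [(hlam k).2]
  have hlam2 : ∀ k, 0 < 1 + lam k := fun k => by linarith [(hlam k).1]
  have hW1 : (1 - W).PosDef := by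
    rw [hWP, Matrix.one_sub_unitary_conj_diagonal hP]
    simpa using (Matrix.posDef_unitary_conj_diagonal_iff hP (fun k => 1 - lam k)).mpr hlam1
  have hne := Matrix.det_one_sub_unitary_mul_ne_zero hU hWpsd hW1
  obtain ⟨had, hadeq⟩ := Matrix.norm_det_one_sub_le hU hWpsd hW1
  obtain ⟨hdb, hdbeq⟩ := Matrix.norm_det_one_sub_le_one_add hU hWpsd hW1
  set a : ℝ := ∏ k, (1 - lam k)
  set b : ℝ := ∏ k, (1 + lam k)
  have ha : 0 < a := Finset.prod_pos fun k _ => hlam1 k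
  have hb : 0 < b := Finset.prod_pos fun k _ => hlam2 k
  have hdeta : (1 - W).det = (a : ℂ) := by
    rw [hWP, Matrix.det_one_sub_unitary_conj_diagonal hP]
    simp [a]
  have hdetb : (1 + W).det = (b : ℂ) := by
    rw [hWP, Matrix.det_one_add_unitary_conj_diagonal hP]
    simp [b]
  have hna : ‖(1 - W).det‖ = a := by
    rw [hdeta, Complex.norm_real, Real.norm_of_nonneg ha.le]
  have hnb : ‖(1 + W).det‖ = b := by
    rw [hdetb, Complex.norm_real, Real.norm_of_nonneg hb.le]
  rw [hna] at had hadeq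
  rw [hnb] at hdb hdbeq
  have hdet2 : (1 - W ^ 2).det = ((a * b : ℝ) : ℂ) := by
    rw [show 1 - W ^ 2 = (1 - W) * (1 + W) by noncomm_ring, Matrix.det_mul, hdeta, hdetb]
    push_cast
    rfl
  have hF : b / a = Real.exp (∑ k, g (lam k)) := by
    simp only [hg, Finset.sum_sub_distrib]
    rw [Real.exp_sub, ← Real.log_prod fun k _ => (hlam2 k).ne',
      ← Real.log_prod fun k _ => (hlam1 k).ne', Real.exp_log hb, Real.exp_log ha]
  rw [prod_prod_rpow_inv hr01, prod_prod_rpow_eq_exp hr01]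
  change _ ∧ ((((Real.exp (∑ i, w i * ∑ k, g (r i k)))⁻¹ : ℝ) : ℂ) ≤ _) ∧
    (_ ≤ ((Real.exp (∑ i, w i * ∑ k, g (r i k)) : ℝ) : ℂ)) ∧
    ((((Real.exp (∑ i, w i * ∑ k, g (r i k)))⁻¹ : ℝ) : ℂ) = _ ↔ _) ∧
    ((((Real.exp (∑ i, w i * ∑ k, g (r i k)))⁻¹ : ℝ) : ℂ) = _ → _) ∧
    (_ = ((Real.exp (∑ i, w i * ∑ k, g (r i k)) : ℝ) : ℂ) ↔ _) ∧
    (_ = ((Real.exp (∑ i, w i * ∑ k, g (r i k)) : ℝ) : ℂ) → _)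
  have hQ : (1 - W ^ 2).det / ((‖(1 - U * W).det‖ ^ 2 : ℝ) : ℂ) =
      ((a * b / ‖(1 - U * W).det‖ ^ 2 : ℝ) : ℂ) := by
    rw [hdet2, Complex.ofReal_div]
  rw [hQ]
  obtain ⟨hL, hR, hLeq, hReq⟩ := mul_div_sq_bounds ha had hdb
    (hF.trans_le (Real.exp_le_exp.mpr hjen))
  rw [hF, Real.exp_eq_exp] at hLeq hReq
  have hall : ∀ Z₀ : Matrix (Fin n) (Fin n) ℂ, (∀ i, Z i = Z₀) →
      W = Z₀ ∧ ∑ k, g (lam k) = ∑ i, w i * ∑ k, g (r i k) := by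
    intro Z₀ h
    have hWZ : W = Z₀ := by
      rw [hW]
      simp only [h]
      rw [← Finset.sum_smul, ← Complex.ofReal_sum, hw1, Complex.ofReal_one, one_smul]
    refine ⟨hWZ, ?_⟩
    have : ∀ i, ∑ k, g (r i k) = ∑ k, g (lam k) := by
      intro i
      rw [← hsum i]
      have hZW : (hZ i).1.eigenvalues = lam := by
        rw [Matrix.IsHermitian.eigenvalues_eq_eigenvalues_iff, h i, hWZ]
      rw [hZW]
    simp only [this]
    rw [← Finset.sum_mul, hw1, one_mul]
  refine ⟨hne, Complex.real_le_real.mpr hL, Complex.real_le_real.mpr hR, ?_, ?_, ?_, ?_⟩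
  · rw [Complex.ofReal_inj, hLeq]
    constructor
    · rintro ⟨h1, h2⟩
      exact ⟨W, hjeneq h2, .inr (by rw [hdbeq h1])⟩
    · rintro ⟨Z₀, h, h1⟩
      obtain ⟨hWZ, h2⟩ := hall Z₀ h
      refine ⟨?_, h2⟩
      rcases h1 with h1 | h1
      -- An eigenvalue `1` would be some `r i k < 1`; an index `i` exists because the weights sum to
      -- `1`.
      · obtain ⟨i⟩ := hm
        rw [← h i, hr i, Multiset.mem_map] at h1
        obtain ⟨k, -, hk⟩ := h1
        exact absurd (by exact_mod_cast hk) (hr01 i k).2.ne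
      · rw [hWZ, det_one_sub_eq_of_spec_eq h1, sub_neg_eq_add, ← hWZ, hnb]
  · rw [Complex.ofReal_inj, hLeq]
    rintro ⟨h1, -⟩ Z₀ h hu
    have h3 := hdbeq h1
    rw [(hall Z₀ h).1] at h3
    exact hu.mul_right_cancel (by rw [h3, neg_one_mul])
  · rw [Complex.ofReal_inj, hReq]
    constructor
    · rintro ⟨h1, h2⟩
      exact ⟨W, hjeneq h2, by rw [hadeq h1]⟩
    · rintro ⟨Z₀, h, h1⟩
      obtain ⟨hWZ, h2⟩ := hall Z₀ h
      refine ⟨?_, h2⟩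
      rw [hWZ, det_one_sub_eq_of_spec_eq h1, ← hWZ, hna]
  · rw [Complex.ofReal_inj, hReq]
    rintro ⟨h1, -⟩ Z₀ h hu
    have h3 := hadeq h1
    rw [(hall Z₀ h).1] at h3
    exact hu.mul_right_cancel (by rw [h3, one_mul])
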